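/- Let $\mathbb{B}_n=\{z\in\mathbb{C}^n:\|z\|<1\}$ and $S^{2n-1}=\{z\in\mathbb{C}^n:\|z\|=1\}$, where $\|\cdot\|$ is the Euclidean norm. For a map $f\colon \mathbb{B}_n\to\mathbb{C}^N$, let $$k_f=\max\bigl\{\dim_{\mathbb{C}}\operatorname{aff}\bigl(f(H\cap\mathbb{B}_n)\bigr) : H\subset\mathbb{C}^n \text{ a complex affine hyperplane}\bigr\},$$ where $\operatorname{aff}(X)$ is the smallest complex affine subspace of $\mathbb{C}^N$ containing $X$. For $d\ge 1$, let $H_d\colon\mathbb{C}^n\to\mathbb{C}^{\binom{n+d-1}{d}}$ be the map whose components, one for each $\alpha\in\mathbb{Z}_{\ge 0}^n$ with $|\alpha|=d$, are $$\sqrt{\tfrac{d!}{\alpha_1!\cdots\alpha_n!}}\; z^\alpha .$$ Theorem. Let $n\ge 2$ and let $f\colon\mathbb{B}_n\to\mathbb{B}_N$ be a proper map which is rational, that is, $f=p/q$ on $\mathbb{B}_n$ for a polynomial map $p\colon\mathbb{C}^n\to\mathbb{C}^N$ and a polynomial $q$ without zeros in $\mathbb{B}_n$. Suppose that $k_f=N-1$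 and that $f(rS^{2n-1})\subset RS^{2N-1}$ for some $r,R\in(0,1)$. Then there exists an integer $d\ge1$ such that $N=\binom{n+d-1}{d}$ and $f=U H_d$ on $\mathbb{B}_n$ for some unitary map $U$ of $\mathbb{C}^N$. -/

import Mathlib

/-- The space `ℂⁿ` with its standard Hermitian norm. -/
abbrev CSpace (n : ℕ) : Type := EuclideanSpace ℂ (Fin n)

/-- The open unit ball of `ℂⁿ`. -/
abbrev unitBall (n : ℕ) : Set (CSpace n) := Metric.ball (0 : CSpace n) 1

/-- A map `f` from an open set `D ⊆ ℂⁿ` to `ℂᴺ` is rational if it is the restriction of `p / q`,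
where `p` is an `N`-tuple of polynomials and `q` is a polynomial.  The denominator has no zeros
in `D`, since `f` has values in `ℂᴺ` at every point of `D`; in particular `f` is holomorphic.
(For `p / q` in lowest terms, a zero of `q` in `D` is a pole or a point of indeterminacy.) -/
def IsRationalMap {n N : ℕ} {D : Set (CSpace n)} (f : D → CSpace N) : Prop :=
  ∃ (p : Fin N → MvPolynomial (Fin n) ℂ) (q : MvPolynomial (Fin n) ℂ),
    ∀ z : D, MvPolynomial.eval (fun i => (z : CSpace n) i) q ≠ 0 ∧
      ∀ j : Fin N, f z j =
        MvPolynomial.eval (fun i => (z : CSpace n) i) (p j) /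
          MvPolynomial.eval (fun i => (z : CSpace n) i) q

/-- Complex affine hyperplanes of `ℂⁿ`. -/
def IsAffineHyperplane {n : ℕ} (H : AffineSubspace ℂ (CSpace n)) : Prop :=
  (H : Set (CSpace n)).Nonempty ∧ Module.finrank ℂ H.direction + 1 = n

/-- The complex dimension of the affine hull of `X ⊆ ℂᴺ` (equal to `0` if `X` is empty). -/
noncomputable def affineHullDim {N : ℕ} (X : Set (CSpace N)) : ℕ :=
  Module.finrank ℂ (affineSpan ℂ X).direction

/-- The affine hull dimensions of `f (H ∩ D)`, with `H` ranging over the affine hyperplanes. -/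
def hyperplaneDims {n N : ℕ} {D : Set (CSpace n)} (f : D → CSpace N) : Set ℕ :=
  {k | ∃ H : AffineSubspace ℂ (CSpace n), IsAffineHyperplane H ∧
    k = affineHullDim (f '' {z : D | (z : CSpace n) ∈ H})}

/-- The supremum below is a maximum. -/
theorem bddAbove_hyperplaneDims {n N : ℕ} {D : Set (CSpace n)} (f : D → CSpace N) :
    BddAbove (hyperplaneDims f) := by
  refine ⟨N, ?_⟩
  rintro k ⟨H, -, rfl⟩
  simpa [affineHullDim] using Submodule.finrank_le
    (affineSpan ℂ (f '' {z : D | (z : CSpace n) ∈ H})).direction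

/-- The general hyperplane rank `k_f` of `f : D → ℂᴺ`: the maximum of `dim aff (f (H ∩ D))`
over all affine hyperplanes `H ⊆ ℂⁿ`. -/
noncomputable def generalHyperplaneRank {n N : ℕ} {D : Set (CSpace n)} (f : D → CSpace N) : ℕ :=
  sSup (hyperplaneDims f)

/-- The multi-indices `α ∈ ℕⁿ` with `|α| = d`. -/
abbrev MultiIndex (n d : ℕ) : Type :=
  {α : Fin n → ℕ // α ∈ Finset.piAntidiag (Finset.univ : Finset (Fin n)) d}

/-- The homogeneous map `H_d`, the symmetrization of `z ↦ z^{⊗ d}`: its components, one for each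
monomial of degree `d`, are `√(d! / (α₁! ⋯ αₙ!)) z^α`. -/
noncomputable def homogeneousMap (n d : ℕ) (z : CSpace n) : EuclideanSpace ℂ (MultiIndex n d) :=
  WithLp.toLp 2 fun α =>
    ((Real.sqrt (Nat.multinomial Finset.univ α.1 : ℝ) : ℝ) : ℂ) * ∏ i, z i ^ α.1 i

/-!
Let `f = p / q`. Properness and the hypothesis on the sphere of radius `r` say that `‖p‖² = |q|²`
for `‖z‖ = 1` and `‖p‖² = R² |q|²` for `‖z‖ = r`. Both identities polarize
(`inner_polyMap_eq_of_sphere`): for `⟨z, w⟩ = 1`,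
`⟨p(z), p(w)⟩ = q(z) conj (q(w))` and `⟨p(z), p(r² w)⟩ = R² q(z) conj (q(r² w))`.
Hence `f` maps the hyperplane `⟨z, w⟩ = 1` into the affine hyperplanes `⟨Z, f(w)⟩ = 1` and
`⟨Z, f(r² w)⟩ = R²`. Since `k_f = N - 1`, the image of a general hyperplane spans an affine
hyperplane, so these two coincide for `w` in a nonempty open set, which gives the polynomial
identity `f(r² w) = R² f(w)` (`dilation_of_generalHyperplaneRank`).

Comparing lowest order terms along complex lines, this relation forces `f` to be a homogeneous
polynomial map `h` of degree `d`, where `r^(2d) = R²` (`MvPolynomial.eval_eq_of_dilation`). By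
properness `‖h(z)‖ = ‖z‖^d = ‖H_d(z)‖`, which polarizes to
`⟨h(z), h(w)⟩ = ⟨z, w⟩^d = ⟨H_d(z), H_d(w)⟩`. The components of `H_d` are a basis of the forms of
degree `d`, so `h = L ∘ H_d` for a linear map `L`, which is then an isometry. It is onto because the
values of `f` on a general hyperplane already span `ℂᴺ`
(`exists_linearIsometryEquiv_of_homogeneous`).
-/

open scoped ComplexConjugate

/-! ### Polarization of polynomial identities -/

section Polarization

open MvPolynomial

/-- The antidiagonal `{(z, conj z)}` is a set of uniqueness for polynomials in `(z, u)`: in the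
coordinates `z = x + i y`, `u = x - i y` it is the set of real points. -/
theorem MvPolynomial.eq_zero_of_eval_conj {σ : Type*} (P : MvPolynomial (σ ⊕ σ) ℂ)
    (h : ∀ z : σ → ℂ, eval (Sum.elim z fun i => conj (z i)) P = 0) : P = 0 := by
  set Q : MvPolynomial (σ ⊕ σ) ℂ := bind₁ (Sum.elim
    (fun i => X (Sum.inl i) + C Complex.I * X (Sum.inr i))
    (fun i => X (Sum.inl i) - C Complex.I * X (Sum.inr i))) P with hQ
  have key : ∀ x y : σ → ℂ, eval (Sum.elim x y) Q =
      eval (Sum.elim (fun i => x i + Complex.I * y i) (fun i => x i - Complex.I * y i)) P := by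
    intro x y
    refine (eval₂Hom_bind₁ (RingHom.id ℂ) (Sum.elim x y) _ P).trans ?_
    refine congrArg (fun g => eval g P) (_root_.funext fun i => ?_)
    rcases i with i | i <;> simp
  have hQ0 : Q = 0 := by
    refine funext_set (fun _ => Set.range ((↑) : ℝ → ℂ))
      (fun _ => Set.infinite_range_of_injective Complex.ofReal_injective) fun x hx => ?_
    choose a ha using fun i => hx i (Set.mem_univ i)
    have hx' : x = Sum.elim (fun i => (a (Sum.inl i) : ℂ)) (fun i => (a (Sum.inr i) : ℂ)) := by
      funext i
      rcases i with i | i <;> simp [ha]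
    rw [hx', key, map_zero]
    convert h (fun i => (a (Sum.inl i) : ℂ) + Complex.I * a (Sum.inr i)) using 4
    simp [sub_eq_add_neg]
  refine MvPolynomial.funext fun v => ?_
  have := key (fun i => (v (Sum.inl i) + v (Sum.inr i)) / 2)
    (fun i => (v (Sum.inl i) - v (Sum.inr i)) / (2 * Complex.I))
  rw [hQ0, map_zero] at this
  rw [map_zero, this]
  refine congrArg (fun g => eval g P) (_root_.funext fun i => ?_)
  have hI := Complex.I_ne_zero
  rcases i with i | i
  · simp only [Sum.elim_inl]; field_simp; ring
  · simp only [Sum.elim_inr]; field_simp; ring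

variable {σ : Type*} [Fintype σ]

theorem MvPolynomial.sum_inl_le_and_sum_inr_le_totalDegree
    {P : MvPolynomial (σ ⊕ σ) ℂ} {m : σ ⊕ σ →₀ ℕ}
    (hm : m ∈ P.support) : ∑ i, m (Sum.inl i) ≤ P.totalDegree ∧
      ∑ i, m (Sum.inr i) ≤ P.totalDegree := by
  have := le_totalDegree hm
  rw [Finsupp.sum_fintype _ _ (fun _ => rfl), Fintype.sum_sum_type] at this
  omega

/-- Up to a power of `ζ`, the function `ζ ↦ P(ζ z, ζ⁻¹ u)` is a polynomial in `ζ`, so that it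
vanishes for all `ζ ≠ 0` if it vanishes on the unit circle. -/
theorem MvPolynomial.eval_rotation_eq_zero (P : MvPolynomial (σ ⊕ σ) ℂ) (z u : σ → ℂ)
    (h : ∀ ζ : ℂ, ‖ζ‖ = 1 → eval (Sum.elim (fun i => ζ * z i) fun i => ζ⁻¹ * u i) P = 0)
    {ζ : ℂ} (hζ : ζ ≠ 0) : eval (Sum.elim (fun i => ζ * z i) fun i => ζ⁻¹ * u i) P = 0 := by
  set D := P.totalDegree
  set K : Polynomial ℂ := ∑ m ∈ P.support,
    Polynomial.C (coeff m P * ((∏ i, z i ^ m (Sum.inl i)) * ∏ i, u i ^ m (Sum.inr i))) *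
      Polynomial.X ^ (∑ i, m (Sum.inl i) + (D - ∑ i, m (Sum.inr i))) with hK
  have key : ∀ ζ : ℂ, ζ ≠ 0 → K.eval ζ =
      ζ ^ D * eval (Sum.elim (fun i => ζ * z i) fun i => ζ⁻¹ * u i) P := by
    intro ζ hζ
    rw [hK, Polynomial.eval_finsetSum, eval_eq', Finset.mul_sum]
    refine Finset.sum_congr rfl fun m hm => ?_
    have hD := (sum_inl_le_and_sum_inr_le_totalDegree hm).2
    simp only [Polynomial.eval_mul, Polynomial.eval_C, Polynomial.eval_pow, Polynomial.eval_X,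
      Fintype.prod_sum_type, Sum.elim_inl, Sum.elim_inr, mul_pow, Finset.prod_mul_distrib,
      Finset.prod_pow_eq_pow_sum]
    rw [pow_add, pow_sub₀ _ hζ hD, inv_pow]
    ring
  have hK0 : K = 0 := by
    have hinf : (Metric.sphere (0 : ℂ) 1).Infinite :=
      (isPreconnected_sphere (by rw [Complex.rank_real_complex]; norm_num) _ _
        ).infinite_of_nontrivial
        ⟨1, by simp, -1, by simp, by norm_num⟩
    refine Polynomial.eq_zero_of_infinite_isRoot K (hinf.mono fun ζ hζ => ?_)
    have h1 : ‖ζ‖ = 1 := by simpa using hζ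
    have h0 : ζ ≠ 0 := by rintro rfl; simp at h1
    change K.eval ζ = 0
    rw [key ζ h0, h ζ h1, mul_zero]
  have := key ζ hζ
  rw [hK0, Polynomial.eval_zero] at this
  exact (mul_eq_zero.1 this.symm).resolve_left (pow_ne_zero _ hζ)

/-- A polynomial `P(z, u)` that vanishes at all `(z, conj z)` with `‖z‖² = s` vanishes on the
complex quadric `z · u = s`. With `t = z · u`, the polynomial `G(z, u) = t^D P((s / t) z, u)` equals
`s^D P(z, u)` on the quadric. It vanishes on the whole antidiagonal, since there
`((s / t) z, conj z)` is of the form `(l z', l⁻¹ conj z')` with `‖z'‖² = s` and `l > 0`. -/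
theorem MvPolynomial.eval_eq_zero_of_sphere (P : MvPolynomial (σ ⊕ σ) ℂ) {s : ℝ} (hs : 0 < s)
    (h : ∀ z : σ → ℂ, ∑ i, ‖z i‖ ^ 2 = s → eval (Sum.elim z fun i => conj (z i)) P = 0)
    {z u : σ → ℂ} (hzu : ∑ i, z i * u i = s) : eval (Sum.elim z u) P = 0 := by
  have hs' : (s : ℂ) ≠ 0 := by exact_mod_cast hs.ne'
  set D := P.totalDegree
  set G : MvPolynomial (σ ⊕ σ) ℂ := ∑ m ∈ P.support,
    C (coeff m P * (s : ℂ) ^ (∑ i, m (Sum.inl i))) *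
      (∑ i, X (Sum.inl i) * X (Sum.inr i)) ^ (D - ∑ i, m (Sum.inl i)) * monomial m 1 with hG
  have key : ∀ z u : σ → ℂ, ∑ i, z i * u i ≠ 0 → eval (Sum.elim z u) G =
      (∑ i, z i * u i) ^ D *
        eval (Sum.elim (fun i => s / (∑ i, z i * u i) * z i) u) P := by
    intro z u ht
    set t := ∑ i, z i * u i with ht'
    rw [hG, map_sum, eval_eq', Finset.mul_sum]
    refine Finset.sum_congr rfl fun m hm => ?_
    have hD := (sum_inl_le_and_sum_inr_le_totalDegree hm).1
    simp only [map_mul, map_pow, map_sum, eval_C, eval_X, eval_monomial, Finsupp.prod_pow,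
      Fintype.prod_sum_type, Sum.elim_inl, Sum.elim_inr, mul_pow, Finset.prod_mul_distrib,
      Finset.prod_pow_eq_pow_sum, ← ht']
    rw [pow_sub₀ _ ht hD, div_pow]
    field_simp
    ring
  have hG0 : G = 0 := by
    -- The factor `z · u` disposes of the point `z = 0` of the antidiagonal, where `key` is silent.
    suffices (∑ i, X (Sum.inl i) * X (Sum.inr i)) * G = 0 by
      rcases mul_eq_zero.1 this with h0 | h0
      · exfalso
        have := congrArg (eval (Sum.elim z u)) h0
        simp [hzu, hs'] at this
      · exact h0
    refine eq_zero_of_eval_conj _ fun z => ?_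
    rw [map_mul]
    by_cases ht : ∑ i, z i * conj (z i) = 0
    · simp [ht]
    have hT : ∑ i, z i * conj (z i) = ((∑ i, ‖z i‖ ^ 2 : ℝ) : ℂ) := by
      push_cast
      exact Finset.sum_congr rfl fun i _ => Complex.mul_conj' (z i)
    rw [key _ _ ht]
    set T : ℝ := ∑ i, ‖z i‖ ^ 2 with hT'
    have hT0 : 0 < T := lt_of_le_of_ne (Finset.sum_nonneg fun i _ => by positivity)
      (fun h => ht (by rw [hT, ← h]; simp))
    set l : ℝ := Real.sqrt (s / T) with hl
    have hl2 : l ^ 2 = s / T := Real.sq_sqrt (by positivity)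
    have hl0 : 0 < l := Real.sqrt_pos.2 (by positivity)
    have hlC : (l : ℂ) ≠ 0 := by exact_mod_cast hl0.ne'
    have := eval_rotation_eq_zero P (fun i => l * z i) (fun i => conj (l * z i)) (fun ζ hζ => by
      have hζi : ζ⁻¹ = conj ζ := Complex.inv_eq_conj hζ
      convert h (fun i => ζ * (l * z i)) ?_ using 4
      · simp [hζi]
      · simp only [norm_mul, hζ, mul_pow, one_mul, Complex.norm_real, Real.norm_eq_abs, sq_abs]
        rw [← Finset.mul_sum, ← hT', hl2]
        field_simp) hlC
    have e1 : (fun i => (l : ℂ) * (l * z i)) = fun i => (s : ℂ) / (∑ i, z i * conj (z i)) * z i := by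
      funext i
      rw [hT, ← mul_assoc, ← sq, ← Complex.ofReal_pow, hl2, Complex.ofReal_div]
    have e2 : (fun i => (l : ℂ)⁻¹ * conj (l * z i)) = fun i => conj (z i) := by
      funext i
      simp [hlC]
    rw [e1, e2] at this
    rw [this, mul_zero, mul_zero]
  have := key z u (by rw [hzu]; exact hs')
  rw [hG0, map_zero, hzu, div_self hs'] at this
  simpa [hs'] using this

theorem MvPolynomial.eval_map_conj {τ : Type*} (g : MvPolynomial τ ℂ) (w : τ → ℂ) :
    eval (fun i => conj (w i)) (map (starRingEnd ℂ) g) = conj (eval w g) := by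
  rw [eval_map, ← coe_eval₂Hom, ← RingHom.comp_apply]
  congr 1
  ext <;> simp

theorem MvPolynomial.eq_zero_of_eventually {n : ℕ} {P : MvPolynomial (Fin n) ℂ} {x : Fin n → ℂ}
    (h : ∀ᶠ w in nhds x, eval w P = 0) : P = 0 := by
  obtain ⟨ε, hε, hball⟩ := Metric.eventually_nhds_iff_ball.1 h
  refine funext_set (fun i => Metric.ball (x i) ε)
    (fun i => infinite_of_mem_nhds (x i) (Metric.ball_mem_nhds _ hε)) fun w hw => ?_
  rw [map_zero]
  exact hball w (by rwa [ball_pi _ hε])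

theorem MvPolynomial.sum_mul_conj_eq_of_sphere {κ : Type*} [Fintype κ] (p : κ → MvPolynomial σ ℂ)
    (q : MvPolynomial σ ℂ) {s : ℝ} (hs : 0 < s) (c : ℂ)
    (h : ∀ z : σ → ℂ, ∑ i, ‖z i‖ ^ 2 = s →
      ∑ j, eval z (p j) * conj (eval z (p j)) = c * (eval z q * conj (eval z q)))
    {z w : σ → ℂ} (hzw : ∑ i, z i * conj (w i) = s) :
    ∑ j, eval z (p j) * conj (eval w (p j)) = c * (eval z q * conj (eval w q)) := by
  set P : MvPolynomial (σ ⊕ σ) ℂ :=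
    ∑ j, rename Sum.inl (p j) * rename Sum.inr (map (starRingEnd ℂ) (p j)) -
      C c * (rename Sum.inl q * rename Sum.inr (map (starRingEnd ℂ) q)) with hP
  have key : ∀ z w : σ → ℂ, eval (Sum.elim z fun i => conj (w i)) P =
      ∑ j, eval z (p j) * conj (eval w (p j)) - c * (eval z q * conj (eval w q)) := by
    intro z w
    simp only [hP, map_sub, map_sum, map_mul, eval_rename, eval_C, ← eval_map_conj]
    rfl
  have := eval_eq_zero_of_sphere P hs (fun z hz => by rw [key, h z hz, sub_self]) hzw
  rwa [key, sub_eq_zero] at this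

end Polarization

/-! ### Rational functions that are homogeneous under a dilation -/

section Dilation

open Polynomial

theorem Polynomial.coeff_mul_of_lt_eq_zero {R : Type*} [CommRing R] (Q g : R[X]) (m : ℕ)
    (h : ∀ k < m, g.coeff k = 0) : (Q * g).coeff m = Q.coeff 0 * g.coeff m := by
  rw [coeff_mul, Finset.sum_eq_single (0, m)]
  · rintro ⟨i, j⟩ hij hne
    rw [Finset.HasAntidiagonal.mem_antidiagonal] at hij
    have : j < m := by
      rcases Nat.eq_zero_or_pos i with rfl | hi
      · exact absurd (by simpa using hij) (fun h : j = m => hne (by rw [h]))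
      · simp only at hij; omega
    rw [h j this, mul_zero]
  · simp

/-- The lowest order terms in the relation `Q(x) e(a x) = b Q(a x) e(x)`, with `Q(0) ≠ 0`, give
`a ^ m = b` for the order `m` of `e` at `0`. -/
theorem Polynomial.pow_natTrailingDegree_of_dilation {e Q : ℂ[X]} {a b : ℂ}
    (hQ : Q.coeff 0 ≠ 0) (h : Q * e.comp (C a * X) = C b * (Q.comp (C a * X) * e)) (he : e ≠ 0) :
    a ^ e.natTrailingDegree = b := by
  have hlt : ∀ k < e.natTrailingDegree, e.coeff k = 0 :=
    fun k hk => coeff_eq_zero_of_lt_natTrailingDegree hk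
  have := congrArg (fun g => g.coeff e.natTrailingDegree) h
  rw [coeff_mul_of_lt_eq_zero _ _ _ (fun k hk => by rw [comp_C_mul_X_coeff, hlt k hk, zero_mul]),
    coeff_C_mul, coeff_mul_of_lt_eq_zero _ _ _ hlt, comp_C_mul_X_coeff, comp_C_mul_X_coeff,
    pow_zero, mul_one] at this
  have h0 : e.coeff e.natTrailingDegree ≠ 0 := trailingCoeff_nonzero_iff_nonzero.2 he
  have h1 : Q.coeff 0 * e.coeff e.natTrailingDegree ≠ 0 := mul_ne_zero hQ h0
  apply mul_left_cancel₀ h1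
  linear_combination this

/-- The relation says that `P / Q` is multiplied by `b = a ^ d` under `x ↦ a x`, so that `P / Q` is
a multiple of `X ^ d`: the difference `P - c X ^ d Q` satisfies the same relation, and `c` is chosen
so that its coefficient of degree `d`, the only possible order at `0`, vanishes. -/
theorem Polynomial.eq_monomial_mul_of_dilation {P Q : ℂ[X]} {a b : ℂ}
    (ha : ∀ m d : ℕ, a ^ m = a ^ d → m = d) (hQ : Q.coeff 0 ≠ 0)
    (h : Q * P.comp (C a * X) = C b * (Q.comp (C a * X) * P))
    {d : ℕ} (hd : a ^ d = b) : P = C (P.coeff d / Q.coeff 0) * X ^ d * Q := by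
  by_contra hne
  set c := P.coeff d / Q.coeff 0 with hc
  have he : P - C c * X ^ d * Q ≠ 0 := sub_ne_zero.2 hne
  have := pow_natTrailingDegree_of_dilation (b := b) hQ (e := P - C c * X ^ d * Q) (a := a) (by
    simp only [sub_comp, mul_comp, C_comp, pow_comp, X_comp, mul_pow]
    rw [mul_sub, h, ← hd, C_pow]
    ring) he
  have hm := ha _ _ (this.trans hd.symm)
  have h0 := trailingCoeff_nonzero_iff_nonzero.2 he
  apply h0
  rw [trailingCoeff, hm, coeff_sub, mul_assoc, coeff_C_mul, coeff_X_pow_mul', if_pos le_rfl,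
    Nat.sub_self, hc]
  field_simp
  ring

open MvPolynomial in
/-- The restriction of `p` to the line through `w` is `∑ k, p_k(w) X ^ k`, where `p_k` is the
homogeneous component of degree `k`. -/
theorem MvPolynomial.aeval_C_mul_X_eq_sum {σ : Type*} (p : MvPolynomial σ ℂ) (w : σ → ℂ) :
    aeval (fun i => Polynomial.C (w i) * Polynomial.X) p =
      ∑ k ∈ Finset.range (p.totalDegree + 1),
        Polynomial.C (eval w (homogeneousComponent k p)) * Polynomial.X ^ k := by
  conv_lhs => rw [← sum_homogeneousComponent p]
  rw [map_sum]
  refine Finset.sum_congr rfl fun k _ => ?_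
  have hh := homogeneousComponent_isHomogeneous k p
  rw [aeval_def, eval₂_eq, eval_eq, map_sum, Finset.sum_mul]
  refine Finset.sum_congr rfl fun m hm => ?_
  have hk : ∑ i ∈ m.support, m i = k := by
    have := hh (mem_support_iff.1 hm)
    simpa [Finsupp.weight_apply, Finsupp.sum] using this
  simp only [mul_pow, Finset.prod_mul_distrib, Finset.prod_pow_eq_pow_sum, hk,
    Polynomial.algebraMap_eq, map_mul, map_prod, map_pow, mul_assoc]

open MvPolynomial in
theorem MvPolynomial.coeff_aeval_C_mul_X {σ : Type*} (p : MvPolynomial σ ℂ) (w : σ → ℂ) (d : ℕ) :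
    (aeval (fun i => Polynomial.C (w i) * Polynomial.X) p : ℂ[X]).coeff d =
      eval w (homogeneousComponent d p) := by
  rw [aeval_C_mul_X_eq_sum]
  simp only [Polynomial.finsetSum_coeff, Polynomial.coeff_C_mul, Polynomial.coeff_X_pow, mul_ite,
    mul_one, mul_zero, Finset.sum_ite_eq, Finset.mem_range]
  split_ifs with h
  · rfl
  · rw [homogeneousComponent_eq_zero _ _ (by omega), map_zero]

open MvPolynomial in
theorem MvPolynomial.eval_aeval_C_mul_X {σ : Type*} (p : MvPolynomial σ ℂ) (w : σ → ℂ) (t : ℂ) :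
    (aeval (fun i => Polynomial.C (w i) * Polynomial.X) p : ℂ[X]).eval t =
      eval (fun i => t * w i) p := by
  rw [← Polynomial.coe_evalRingHom, ← AlgHom.coe_toRingHom, ← RingHom.comp_apply]
  congr 1
  refine MvPolynomial.ringHom_ext (fun c => ?_) fun i => ?_
  · simp
  · simpa using mul_comm _ _

open MvPolynomial in
theorem MvPolynomial.dilation_aeval {σ : Type*} {p q : MvPolynomial σ ℂ} {a b : ℂ}
    (h : ∀ w, eval w q * eval (fun i => a * w i) p = b * (eval (fun i => a * w i) q * eval w p))
    (w : σ → ℂ) :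
    let P : ℂ[X] := aeval (fun i => Polynomial.C (w i) * Polynomial.X) p
    let Q : ℂ[X] := aeval (fun i => Polynomial.C (w i) * Polynomial.X) q
    Q * P.comp (Polynomial.C a * Polynomial.X) =
      Polynomial.C b * (Q.comp (Polynomial.C a * Polynomial.X) * P) := by
  refine Polynomial.funext fun t => ?_
  have := h fun i => t * w i
  simp only [Polynomial.eval_mul, Polynomial.eval_comp, Polynomial.eval_C, Polynomial.eval_X,
    eval_aeval_C_mul_X, mul_assoc]
  simpa only [mul_assoc] using this

open MvPolynomial in
/-- If `p / q` is multiplied by `b = a ^ d` under `w ↦ a w`, where `q(0) ≠ 0` and the powers of `a`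
are distinct, then `p / q` is the homogeneous polynomial `p_d / q(0)`. -/
theorem MvPolynomial.eval_eq_of_dilation {σ : Type*} {p q : MvPolynomial σ ℂ} {a b : ℂ}
    (ha : ∀ m d : ℕ, a ^ m = a ^ d → m = d) (hq : eval 0 q ≠ 0)
    (h : ∀ w, eval w q * eval (fun i => a * w i) p = b * (eval (fun i => a * w i) q * eval w p))
    {d : ℕ} (hd : a ^ d = b) (w : σ → ℂ) :
    eval w p = eval w (C (eval 0 q)⁻¹ * homogeneousComponent d p) * eval w q := by
  have hQ : (aeval (fun i => Polynomial.C (w i) * Polynomial.X) q : ℂ[X]).coeff 0 = eval 0 q := by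
    rw [Polynomial.coeff_zero_eq_eval_zero, eval_aeval_C_mul_X]
    simp only [zero_mul]
    rfl
  have := Polynomial.eq_monomial_mul_of_dilation ha (by rwa [hQ]) (dilation_aeval h w) hd
  have := congrArg (Polynomial.eval 1) this
  rw [hQ, coeff_aeval_C_mul_X] at this
  simp only [Polynomial.eval_mul, Polynomial.eval_C, Polynomial.eval_pow, Polynomial.eval_X,
    eval_aeval_C_mul_X, one_mul, one_pow, mul_one] at this
  rw [this, map_mul, eval_C]
  ring

open MvPolynomial in
/-- If `b` is not a power of `a`, then no nonzero `p / q` is multiplied by `b` under `w ↦ a w`. -/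
theorem MvPolynomial.eval_eq_zero_of_dilation {σ : Type*} {p q : MvPolynomial σ ℂ} {a b : ℂ}
    (hq : eval 0 q ≠ 0)
    (h : ∀ w, eval w q * eval (fun i => a * w i) p = b * (eval (fun i => a * w i) q * eval w p))
    (hd : ∀ d : ℕ, a ^ d ≠ b) (w : σ → ℂ) : eval w p = 0 := by
  have hQ : (aeval (fun i => Polynomial.C (w i) * Polynomial.X) q : ℂ[X]).coeff 0 ≠ 0 := by
    rw [Polynomial.coeff_zero_eq_eval_zero, eval_aeval_C_mul_X]
    simp only [zero_mul]
    exact hq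
  by_contra hne
  refine hd _ (Polynomial.pow_natTrailingDegree_of_dilation hQ (dilation_aeval h w) ?_)
  intro h0
  have := congrArg (Polynomial.eval 1) h0
  rw [eval_aeval_C_mul_X, Polynomial.eval_zero] at this
  exact hne (by simpa using this)

end Dilation

/-! ### Images of hyperplanes of full affine dimension -/

section AffineGeometry

open Filter Topology

/-- Affinely independent points of an affine hyperplane that misses the origin are linearly
independent. -/
theorem linearIndependent_of_affineIndependent_of_inner_eq {V ι : Type*} [NormedAddCommGroup V]
    [InnerProductSpace ℂ V] [Fintype ι] {g : ι → V} (hg : AffineIndependent ℂ g) {a : V} {b : ℂ}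
    (hb : b ≠ 0) (h : ∀ i, inner ℂ a (g i) = b) : LinearIndependent ℂ g := by
  rw [Fintype.linearIndependent_iff]
  intro c hc i
  have h0 : ∑ i, c i = 0 := by
    have := congrArg (inner ℂ a) hc
    simp only [inner_sum, inner_smul_right, h, inner_zero_right, ← Finset.sum_mul] at this
    exact (mul_eq_zero.1 this).resolve_right hb
  exact hg.eq_zero_of_sum_eq_zero h0 hc i (Finset.mem_univ i)

theorem eq_zero_of_inner_eq_zero_of_linearIndependent {N : ℕ} {g : Fin N → CSpace N}
    (hg : LinearIndependent ℂ g) {e : CSpace N} (h : ∀ i, inner ℂ e (g i) = 0) : e = 0 := by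
  have htop := hg.span_eq_top_of_card_eq_finrank' (by simp)
  have : ∀ y ∈ Submodule.span ℂ (Set.range g), inner ℂ e y = 0 := by
    intro y hy
    induction hy using Submodule.span_induction with
    | mem x hx => obtain ⟨i, rfl⟩ := hx; exact h i
    | zero => simp
    | add x y _ _ hx hy => rw [inner_add_right, hx, hy, add_zero]
    | smul c x _ hx => rw [inner_smul_right, hx, mul_zero]
  exact inner_self_eq_zero.1 (this e (by rw [htop]; trivial))

theorem IsAffineHyperplane.exists_inner_eq {n : ℕ} {H : AffineSubspace ℂ (CSpace n)}
    (hH : IsAffineHyperplane H) : ∃ (v : CSpace n) (c : ℂ), v ≠ 0 ∧ ∀ z ∈ H, inner ℂ v z = c := by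
  obtain ⟨⟨p, hp⟩, hdim⟩ := hH
  have hne : H.directionᗮ ≠ ⊥ := by
    intro hbot
    rw [Submodule.orthogonal_eq_bot_iff] at hbot
    rw [hbot, finrank_top, finrank_euclideanSpace_fin] at hdim
    omega
  obtain ⟨v, hv, hv0⟩ := Submodule.exists_mem_ne_zero_of_ne_bot hne
  refine ⟨v, inner ℂ v p, hv0, fun z hz => ?_⟩
  have := Submodule.inner_left_of_mem_orthogonal (AffineSubspace.vsub_mem_direction hz hp) hv
  rwa [vsub_eq_sub, inner_sub_right, sub_eq_zero] at this

theorem exists_isAffineHyperplane {n : ℕ} (hn : 1 ≤ n) :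
    ∃ H : AffineSubspace ℂ (CSpace n), IsAffineHyperplane H := by
  obtain ⟨m, rfl⟩ : ∃ m, n = m + 1 := ⟨n - 1, by omega⟩
  have : Fact (Module.finrank ℂ (CSpace (m + 1)) = m + 1) := ⟨by simp⟩
  have hv : EuclideanSpace.single (0 : Fin (m + 1)) (1 : ℂ) ≠ 0 := by
    intro h
    simpa using congrArg (fun z : CSpace (m + 1) => z 0) h
  refine ⟨(Submodule.span ℂ {EuclideanSpace.single (0 : Fin (m + 1)) (1 : ℂ)})ᗮ.toAffineSubspace,
    ⟨0, ?_⟩, ?_⟩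
  · exact Submodule.zero_mem _
  · rw [Submodule.toAffineSubspace_direction,
      Submodule.finrank_orthogonal_span_singleton (n := m) hv]

theorem exists_affineIndependent_of_generalHyperplaneRank {n N : ℕ} (hn : 1 ≤ n)
    (F : CSpace n → CSpace N)
    (hk : generalHyperplaneRank (fun z : unitBall n => F z) + 1 = N) :
    ∃ (v : CSpace n) (c : ℂ) (x : Fin N → CSpace n), v ≠ 0 ∧ (∀ i, x i ∈ unitBall n) ∧
      (∀ i, inner ℂ v (x i) = c) ∧ AffineIndependent ℂ fun i => F (x i) := by
  obtain ⟨H₁, hH₁⟩ := exists_isAffineHyperplane hn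
  have hmem := Nat.sSup_mem (s := hyperplaneDims fun z : unitBall n => F z) ⟨_, H₁, hH₁, rfl⟩
    (bddAbove_hyperplaneDims _)
  obtain ⟨H, hH, hHk⟩ := hmem
  change generalHyperplaneRank (fun z : unitBall n => F z) = _ at hHk
  obtain ⟨v, c, hv, hc⟩ := hH.exists_inner_eq
  obtain ⟨t, hts, hspan, hind⟩ := exists_affineIndependent ℂ (CSpace N)
    ((fun z : unitBall n => F z) '' {z | (z : CSpace n) ∈ H})
  rw [hHk, affineHullDim, ← hspan, direction_affineSpan] at hk
  have : Finite t := finite_of_fin_dim_affineIndependent ℂ hind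
  have := Fintype.ofFinite t
  rcases isEmpty_or_nonempty t with ht | ht
  · -- The affine hull of the empty set has dimension `0`, so that `N = 1` and any point will do.
    have ht0 : t = ∅ := Set.isEmpty_coe_sort.1 ht
    subst ht0
    rw [vectorSpan_empty, finrank_bot] at hk
    have hN : N = 1 := hk.symm
    subst hN
    exact ⟨v, 0, fun _ => 0, hv, fun _ => by simp, fun _ => by simp,
      affineIndependent_of_subsingleton ℂ _⟩
  · have hcard := hind.finrank_vectorSpan_add_one
    rw [Subtype.range_coe, hk] at hcard
    have e : Fin N ≃ t := Fintype.equivOfCardEq (by simp [hcard])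
    choose z hz hFz using fun i => hts (e i).2
    exact ⟨v, c, fun i => z i, hv, fun i => (z i).2, fun i => hc _ (hz i), by
      rw [show (fun i => F (z i)) = ((↑) : t → CSpace N) ∘ e from funext hFz]
      exact hind.comp_embedding e.toEmbedding⟩

theorem eventually_mem_ball_affineIndependent {n N : ℕ} {F : CSpace n → CSpace N}
    (hF : ContinuousOn F (unitBall n)) {x : Fin N → CSpace n} (hx : ∀ i, x i ∈ unitBall n)
    (hind : AffineIndependent ℂ fun i => F (x i)) :
    ∀ᶠ y in 𝓝 x, (∀ i, y i ∈ unitBall n) ∧ AffineIndependent ℂ fun i => F (y i) := by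
  refine (eventually_all.2 fun i => ?_).and ?_
  · exact (continuous_apply i).continuousAt.eventually_mem (Metric.isOpen_ball.mem_nhds (hx i))
  · have hcont : ContinuousAt (fun y : Fin N → CSpace n => fun i => F (y i)) x :=
      continuousAt_pi.2 fun i => ContinuousAt.comp (g := F)
        (hF.continuousAt (Metric.isOpen_ball.mem_nhds (hx i))) (continuous_apply i).continuousAt
    exact hcont.eventually_mem (isOpen_setOfPred_affineIndependent.mem_nhds hind)

/-- The rank `k_f = N - 1` is attained on a hyperplane that misses the origin, that is, on one of the
form `⟨z, w⟩ = 1`. -/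
theorem exists_affineIndependent_inner_eq_one {n N : ℕ} (hn : 1 ≤ n) {F : CSpace n → CSpace N}
    (hF : ContinuousOn F (unitBall n))
    (hk : generalHyperplaneRank (fun z : unitBall n => F z) + 1 = N) :
    ∃ (w : CSpace n) (x : Fin N → CSpace n), (∀ i, x i ∈ unitBall n) ∧
      (∀ i, inner ℂ w (x i) = 1) ∧ AffineIndependent ℂ fun i => F (x i) := by
  obtain ⟨v, c, x, hv, hx, hc, hind⟩ := exists_affineIndependent_of_generalHyperplaneRank hn F hk
  suffices ∃ (c : ℂ) (x : Fin N → CSpace n), c ≠ 0 ∧ (∀ i, x i ∈ unitBall n) ∧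
      (∀ i, inner ℂ v (x i) = c) ∧ AffineIndependent ℂ fun i => F (x i) by
    obtain ⟨c, x, hc0, hx, hc, hind⟩ := this
    refine ⟨(conj c)⁻¹ • v, x, hx, fun i => ?_, hind⟩
    rw [inner_smul_left, hc, map_inv₀, Complex.conj_conj, inv_mul_cancel₀ hc0]
  by_cases hc0 : c = 0
  · -- A hyperplane through the origin is moved off the origin by a small translation along `v`.
    have hcont : Tendsto (fun ε : ℂ => fun i => x i + ε • v) (𝓝[≠] 0) (𝓝 x) := by
      have : Continuous fun ε : ℂ => fun i => x i + ε • v := by fun_prop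
      have h := this.tendsto 0
      simp only [zero_smul, add_zero] at h
      exact h.mono_left nhdsWithin_le_nhds
    obtain ⟨ε, ⟨hε, hε'⟩, hε0⟩ := ((hcont.eventually
      (eventually_mem_ball_affineIndependent hF hx hind)).and
        (self_mem_nhdsWithin (s := ({0}ᶜ : Set ℂ)))).exists
    refine ⟨ε * inner ℂ v v, fun i => x i + ε • v, mul_ne_zero hε0 (inner_self_ne_zero.2 hv), hε,
      fun i => ?_, hε'⟩
    rw [inner_add_right, inner_smul_right, hc, hc0, zero_add]
  · exact ⟨c, x, hc0, hx, hc, hind⟩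

/-- The rank `k_f = N - 1` is attained on all hyperplanes `⟨z, w⟩ = 1` with `w` in some nonempty open
set: the points `x i` may be rescaled to lie on a nearby hyperplane. -/
theorem eventually_exists_affineIndependent {n N : ℕ} (hn : 1 ≤ n) {F : CSpace n → CSpace N}
    (hF : ContinuousOn F (unitBall n))
    (hk : generalHyperplaneRank (fun z : unitBall n => F z) + 1 = N) :
    ∃ w₀ : CSpace n, ∀ᶠ w in 𝓝 w₀, ∃ y : Fin N → CSpace n, (∀ i, y i ∈ unitBall n) ∧
      (∀ i, inner ℂ w (y i) = 1) ∧ AffineIndependent ℂ fun i => F (y i) := by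
  obtain ⟨w₀, x, hx, hw, hind⟩ := exists_affineIndependent_inner_eq_one hn hF hk
  refine ⟨w₀, ?_⟩
  have hin : ∀ i, Continuous fun w : CSpace n => inner ℂ w (x i) := fun i => by fun_prop
  have hcont : Tendsto (fun w : CSpace n => fun i => (inner ℂ w (x i))⁻¹ • x i) (𝓝 w₀) (𝓝 x) := by
    refine tendsto_pi_nhds.2 fun i => ?_
    have := (((hin i).tendsto w₀).inv₀ (by rw [hw]; exact one_ne_zero)).smul_const (x i)
    simpa [hw] using this
  have hne : ∀ᶠ w in 𝓝 w₀, ∀ i, inner ℂ w (x i) ≠ 0 :=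
    eventually_all.2 fun i => (hin i).continuousAt.eventually_ne (by rw [hw]; exact one_ne_zero)
  filter_upwards [hcont.eventually (eventually_mem_ball_affineIndependent hF hx hind), hne]
    with w hw' hw0
  exact ⟨_, hw'.1, fun i => by rw [inner_smul_right, inv_mul_cancel₀ (hw0 i)], hw'.2⟩

end AffineGeometry

/-! ### Boundary values of proper maps -/

section ProperMaps

open Filter Topology

/-- A proper map of balls maps points close to the unit sphere to points close to the unit sphere. -/
theorem tendsto_norm_of_isProperMap {n N : ℕ} {f : unitBall n → unitBall N} (hf : IsProperMap f)
    {F : CSpace n → CSpace N} (hF : ∀ z : unitBall n, F z = f z) {ζ : CSpace n} (hζ : ‖ζ‖ = 1) :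
    Tendsto (fun z => ‖F z‖) (𝓝[unitBall n] ζ) (𝓝 1) := by
  refine tendsto_order.2 ⟨fun a ha => ?_, fun a ha => ?_⟩
  · have hK : IsCompact ((↑) ⁻¹' Metric.closedBall (0 : CSpace N) a : Set (unitBall N)) := by
      rw [Subtype.isCompact_iff, Subtype.image_preimage_coe, Set.inter_eq_right.2]
      · exact isCompact_closedBall _ _
      · exact Metric.closedBall_subset_ball ha
    have hC := (hf.isCompact_preimage hK).image continuous_subtype_val
    have hζC : ζ ∉ ((↑) : unitBall n → CSpace n) ''
        (f ⁻¹' ((↑) ⁻¹' Metric.closedBall (0 : CSpace N) a)) := by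
      rintro ⟨z, -, rfl⟩
      have := z.2
      rw [mem_ball_zero_iff] at this
      linarith
    filter_upwards [mem_nhdsWithin_of_mem_nhds (hC.isClosed.isOpen_compl.mem_nhds hζC),
      self_mem_nhdsWithin] with z hz hzb
    by_contra hle
    refine hz ⟨⟨z, hzb⟩, ?_, rfl⟩
    rw [Set.mem_preimage, Set.mem_preimage, mem_closedBall_zero_iff, ← hF]
    exact not_lt.1 hle
  · filter_upwards [self_mem_nhdsWithin] with z hz
    have := (f ⟨z, hz⟩).2
    rw [mem_ball_zero_iff, ← hF] at this
    exact this.trans ha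

theorem neBot_nhdsWithin_unitBall {n : ℕ} {ζ : CSpace n} (hζ : ‖ζ‖ = 1) :
    (𝓝[unitBall n] ζ).NeBot := by
  rw [← mem_closure_iff_nhdsWithin_neBot, closure_ball _ one_ne_zero]
  simp [hζ]

end ProperMaps

/-! ### Rational maps and polarized spheres -/

section RationalMaps

open MvPolynomial Filter Topology

/-- The map `ℂⁿ → ℂᴺ` given by an `N`-tuple of polynomials. -/
noncomputable def polyMap {n N : ℕ} (p : Fin N → MvPolynomial (Fin n) ℂ) (z : CSpace n) :
    CSpace N :=
  WithLp.toLp 2 fun j => eval z (p j)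

theorem polyMap_apply {n N : ℕ} (p : Fin N → MvPolynomial (Fin n) ℂ) (z : CSpace n) (j : Fin N) :
    polyMap p z j = eval z (p j) := rfl

theorem continuous_polyMap {n N : ℕ} (p : Fin N → MvPolynomial (Fin n) ℂ) :
    Continuous (polyMap p) :=
  (PiLp.continuous_toLp 2 _).comp (continuous_pi fun j =>
    (MvPolynomial.continuous_eval (p j)).comp (PiLp.continuous_ofLp 2 _))

theorem inner_polyMap {n N : ℕ} (p : Fin N → MvPolynomial (Fin n) ℂ) (z w : CSpace n) :
    inner ℂ (polyMap p w) (polyMap p z) = ∑ j, eval z (p j) * conj (eval w (p j)) := by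
  simp [PiLp.inner_apply, polyMap_apply]

/-- If `‖p‖² = c |q|²` on the sphere of radius `√s`, then `⟨p(z), p(w)⟩ = c q(z) conj(q(w))`
on the polarized sphere `⟨z, w⟩ = s`. -/
theorem inner_polyMap_eq_of_sphere {n N : ℕ} {p : Fin N → MvPolynomial (Fin n) ℂ}
    {q : MvPolynomial (Fin n) ℂ} {s c : ℝ} (hs : 0 < s)
    (h : ∀ z : CSpace n, ‖z‖ ^ 2 = s → ‖polyMap p z‖ ^ 2 = c * ‖eval z q‖ ^ 2)
    {z w : CSpace n} (hzw : inner ℂ w z = s) :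
    inner ℂ (polyMap p w) (polyMap p z) = c * (eval z q * conj (eval w q)) := by
  rw [inner_polyMap]
  refine sum_mul_conj_eq_of_sphere p q hs c (fun u hu => ?_) ?_
  · have := h (WithLp.toLp 2 u) (by rw [EuclideanSpace.norm_sq_eq]; exact hu)
    rw [EuclideanSpace.norm_sq_eq] at this
    have := congrArg ((↑) : ℝ → ℂ) this
    push_cast at this
    simpa only [Complex.mul_conj', polyMap_apply] using this
  · rw [← hzw]
    simp [PiLp.inner_apply]

/-- If `F = p / q` has hyperplane rank `N - 1`, and `‖p‖² = |q|²` on the unit sphere and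
`‖p‖² = c |q|²` on the sphere of radius `√s`, then `F(s w) = c F(w)`, as an identity between
polynomials after clearing denominators. Moreover the values of `F` in the ball span `ℂᴺ`. -/
theorem dilation_of_generalHyperplaneRank {n N : ℕ} (hn : 1 ≤ n)
    {p : Fin N → MvPolynomial (Fin n) ℂ} {q : MvPolynomial (Fin n) ℂ} {F : CSpace n → CSpace N}
    (hq : ∀ z ∈ unitBall n, eval z q ≠ 0)
    (hF : ∀ z ∈ unitBall n, F z = (eval z q)⁻¹ • polyMap p z)
    (hk : generalHyperplaneRank (fun z : unitBall n => F z) + 1 = N)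
    {s c : ℝ} (hs : 0 < s)
    (h1 : ∀ z : CSpace n, ‖z‖ ^ 2 = 1 → ‖polyMap p z‖ ^ 2 = ‖eval z q‖ ^ 2)
    (h2 : ∀ z : CSpace n, ‖z‖ ^ 2 = s → ‖polyMap p z‖ ^ 2 = c * ‖eval z q‖ ^ 2) :
    (∃ y : Fin N → unitBall n, LinearIndependent ℂ fun i => F (y i)) ∧
    ∀ (j : Fin N) (w : Fin n → ℂ), eval w q * eval (fun i => (s : ℂ) * w i) (p j) =
      c * (eval (fun i => (s : ℂ) * w i) q * eval w (p j)) := by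
  have hcont : ContinuousOn F (unitBall n) := by
    refine ContinuousOn.congr ?_ hF
    exact (((MvPolynomial.continuous_eval q).comp (PiLp.continuous_ofLp 2 _)).continuousOn.inv₀
      hq).smul (continuous_polyMap p).continuousOn
  obtain ⟨w₀, hw₀⟩ := eventually_exists_affineIndependent hn hcont hk
  have hq0 : q ≠ 0 := by
    rintro rfl
    exact hq 0 (by simp) (map_zero _)
  -- On the hyperplane `⟨z, w⟩ = 1`, where `q(w) ≠ 0`, the polarized identity on the unit sphere
  -- confines `F` to the affine hyperplane `⟨Z, p(w)⟩ = conj (q(w))`, which misses the origin.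
  have hlin : ∀ w : CSpace n, eval w q ≠ 0 → ∀ y : Fin N → CSpace n, (∀ i, y i ∈ unitBall n) →
      (∀ i, inner ℂ w (y i) = 1) → (AffineIndependent ℂ fun i => F (y i)) →
      LinearIndependent ℂ fun i => F (y i) := by
    intro w hw y hy hwy hind
    refine linearIndependent_of_affineIndependent_of_inner_eq hind (a := polyMap p w)
      (b := conj (eval w q)) (by simpa using hw) fun i => ?_
    have := inner_polyMap_eq_of_sphere (s := 1) (c := 1) one_pos (by simpa using h1)
      (z := y i) (w := w) (by simp [hwy])
    rw [hF _ (hy i), inner_smul_right, this, Complex.ofReal_one, one_mul,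
      inv_mul_cancel_left₀ (hq _ (hy i))]
  -- Combining both polarized identities, `q(w) p(s w) - c q(s w) p(w)` is orthogonal to `F` on that
  -- hyperplane, hence to `N` independent vectors. The extra factor `q(w)` covers the zeros of `q`.
  have hE : ∀ᶠ w : CSpace n in 𝓝 w₀, ∀ j,
      eval w q * (eval w q * eval (fun i => (s : ℂ) * w i) (p j) -
        c * (eval (fun i => (s : ℂ) * w i) q * eval w (p j))) = 0 := by
    filter_upwards [hw₀] with w ⟨y, hy, hwy, hind⟩ j
    by_cases hw : eval w q = 0
    · rw [hw, zero_mul]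
    have hli := hlin w hw y hy hwy hind
    have hsw : (((s : ℂ) • w : CSpace n) : Fin n → ℂ) = fun i => (s : ℂ) * w i := rfl
    have hzero := eq_zero_of_inner_eq_zero_of_linearIndependent hli
      (e := eval w q • polyMap p ((s : ℂ) • w) -
        ((c : ℂ) * eval ((s : ℂ) • w : CSpace n) q) • polyMap p w) fun i => by
      have e1 := inner_polyMap_eq_of_sphere (s := 1) (c := 1) one_pos (by simpa using h1)
        (z := y i) (w := w) (by simp [hwy])
      have e2 := inner_polyMap_eq_of_sphere hs h2 (z := y i) (w := (s : ℂ) • w)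
        (by rw [inner_smul_left, hwy, Complex.conj_ofReal, mul_one])
      rw [hF _ (hy i), inner_smul_right, inner_sub_left, inner_smul_left, inner_smul_left, e1, e2]
      simp only [map_mul, Complex.conj_ofReal, Complex.ofReal_one]
      ring
    have := congrArg (fun v : CSpace N => v j) hzero
    simp only [PiLp.sub_apply, PiLp.smul_apply, polyMap_apply, smul_eq_mul, PiLp.zero_apply,
      hsw] at this
    rw [← mul_assoc (c : ℂ), this, mul_zero]
  -- The dilated polynomial.
  have hdil : ∀ (g : MvPolynomial (Fin n) ℂ) (w : Fin n → ℂ),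
      eval w (bind₁ (fun i => C (s : ℂ) * X i) g) = eval (fun i => (s : ℂ) * w i) g := by
    intro g w
    refine (eval₂Hom_bind₁ (RingHom.id ℂ) w _ g).trans ?_
    refine congrArg (fun x => eval x g) (_root_.funext fun i => ?_)
    simp
  refine ⟨?_, fun j w => ?_⟩
  · by_contra hno
    refine hq0 (eq_zero_of_eventually (x := w₀) ?_)
    filter_upwards [((PiLp.continuous_toLp 2 _).tendsto (w₀ : Fin n → ℂ)).eventually hw₀]
      with w ⟨y, hy, hwy, hind⟩
    by_contra hw
    exact hno ⟨fun i => ⟨y i, hy i⟩, hlin _ hw y hy hwy hind⟩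
  · have hP : q * (q * bind₁ (fun i => C (s : ℂ) * X i) (p j) -
        C (c : ℂ) * (bind₁ (fun i => C (s : ℂ) * X i) q * p j)) = 0 := by
      refine eq_zero_of_eventually (x := w₀) ?_
      filter_upwards [((PiLp.continuous_toLp 2 _).tendsto (w₀ : Fin n → ℂ)).eventually hE]
        with w hw
      simpa only [map_mul, map_sub, hdil, eval_C] using hw j
    have := congrArg (eval w) ((mul_eq_zero.1 hP).resolve_left hq0)
    simp only [map_mul, map_sub, hdil, eval_C, map_zero] at this
    exact sub_eq_zero.1 this

end RationalMaps

/-! ### The homogeneous map `H_d` -/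

section HomogeneousMaps

open MvPolynomial

theorem card_multiIndex (n d : ℕ) : Fintype.card (MultiIndex n d) = (n + d - 1).choose d := by
  have e : MultiIndex n d ≃ {m // m ∈ Finset.finsuppAntidiag (Finset.univ : Finset (Fin n)) d} :=
    (Finsupp.equivFunOnFinite.symm.subtypeEquiv fun α => by
      simp [Finset.mem_piAntidiag, Finset.mem_finsuppAntidiag])
  rw [Fintype.card_congr e, Fintype.card_coe, Finset.card_finsuppAntidiag_nat_eq_choose,
    Finset.card_univ, Fintype.card_fin]

theorem homogeneousMap_apply (n d : ℕ) (z : CSpace n) (α : MultiIndex n d) :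
    homogeneousMap n d z α =
      ((Real.sqrt (Nat.multinomial Finset.univ α.1 : ℝ) : ℝ) : ℂ) * ∏ i, z i ^ α.1 i := rfl

theorem sqrt_multinomial_ne_zero {n : ℕ} (α : Fin n → ℕ) :
    ((Real.sqrt (Nat.multinomial Finset.univ α : ℝ) : ℝ) : ℂ) ≠ 0 := by
  have := Nat.multinomial_pos Finset.univ α
  exact_mod_cast (Real.sqrt_pos.2 (by exact_mod_cast this)).ne'

theorem inner_homogeneousMap (n d : ℕ) (z w : CSpace n) :
    inner ℂ (homogeneousMap n d w) (homogeneousMap n d z) = inner ℂ w z ^ d := by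
  simp only [PiLp.inner_apply, RCLike.inner_apply, homogeneousMap_apply]
  rw [Finset.sum_pow_eq_sum_piAntidiag]
  refine Eq.trans ?_ (Finset.sum_coe_sort (Finset.piAntidiag (Finset.univ : Finset (Fin n)) d)
    fun α => (Nat.multinomial Finset.univ α : ℂ) * ∏ i, (z i * conj (w i)) ^ α i)
  refine Finset.sum_congr rfl fun α _ => ?_
  have hs : ((Real.sqrt (Nat.multinomial Finset.univ α.1 : ℝ) : ℝ) : ℂ) ^ 2 =
      (Nat.multinomial Finset.univ α.1 : ℂ) := by
    rw [← Complex.ofReal_pow, Real.sq_sqrt (by positivity), Complex.ofReal_natCast]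
  rw [← hs]
  simp only [map_mul, map_prod, map_pow, Complex.conj_ofReal, mul_pow, Finset.prod_mul_distrib]
  ring

/-- A vector orthogonal to all values of `H_d` is a vanishing linear combination of distinct
monomials. -/
theorem span_range_homogeneousMap (n d : ℕ) :
    Submodule.span ℂ (Set.range (homogeneousMap n d)) = ⊤ := by
  rw [← Submodule.orthogonal_eq_bot_iff, Submodule.eq_bot_iff]
  intro b hb
  have h0 : ∀ z : CSpace n, inner ℂ b (homogeneousMap n d z) = 0 := fun z =>
    Submodule.inner_left_of_mem_orthogonal (Submodule.subset_span (Set.mem_range_self z)) hb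
  set P : MvPolynomial (Fin n) ℂ := ∑ α : MultiIndex n d,
    monomial (Finsupp.equivFunOnFinite.symm α.1)
      (((Real.sqrt (Nat.multinomial Finset.univ α.1 : ℝ) : ℝ) : ℂ) * conj (b α)) with hP
  have hP0 : P = 0 := by
    refine MvPolynomial.funext fun z => ?_
    have := h0 (WithLp.toLp 2 z)
    simp only [PiLp.inner_apply, RCLike.inner_apply, homogeneousMap_apply] at this
    rw [hP, map_sum, map_zero, ← this]
    refine Finset.sum_congr rfl fun α _ => ?_
    rw [eval_monomial, Finsupp.prod_pow]
    simp only [Finsupp.equivFunOnFinite_symm_apply_apply]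
    ring
  ext α
  have := congrArg (coeff (Finsupp.equivFunOnFinite.symm α.1)) hP0
  rw [hP, coeff_sum, Finset.sum_eq_single α] at this
  · rw [coeff_monomial, if_pos rfl, coeff_zero] at this
    simpa using (mul_eq_zero.1 this).resolve_left (sqrt_multinomial_ne_zero α.1)
  · intro β _ hne
    rw [coeff_monomial, if_neg]
    intro h
    exact hne (Subtype.ext (Finsupp.equivFunOnFinite.symm.injective h))
  · simp

theorem MvPolynomial.IsHomogeneous.eval_eq_sum_multiIndex {n d : ℕ} {g : MvPolynomial (Fin n) ℂ}
    (hg : g.IsHomogeneous d) (z : Fin n → ℂ) :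
    eval z g = ∑ α : MultiIndex n d,
      coeff (Finsupp.equivFunOnFinite.symm α.1) g * ∏ i, z i ^ α.1 i := by
  have hsum : ∑ α : MultiIndex n d,
      coeff (Finsupp.equivFunOnFinite.symm α.1) g * ∏ i, z i ^ α.1 i =
      ∑ α ∈ Finset.piAntidiag (Finset.univ : Finset (Fin n)) d,
        coeff (Finsupp.equivFunOnFinite.symm α) g * ∏ i, z i ^ α i :=
    Finset.sum_coe_sort (Finset.piAntidiag (Finset.univ : Finset (Fin n)) d)
      fun α => coeff (Finsupp.equivFunOnFinite.symm α) g * ∏ i, z i ^ α i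
  rw [hsum, eval_eq']
  refine Finset.sum_bij_ne_zero (fun m _ _ => ⇑m) (fun m hm _ => ?_) (fun m _ _ m' _ _ h => ?_)
    (fun α hα hne => ?_) (fun m _ _ => ?_)
  · have := hg.degree_eq_sum_deg_support hm
    simp only [Finset.mem_piAntidiag, Finset.mem_univ, implies_true, and_true]
    rw [this, ← Finsupp.degree_eq_sum]
    rfl
  · exact DFunLike.coe_injective h
  · refine ⟨Finsupp.equivFunOnFinite.symm α, mem_support_iff.2 (left_ne_zero_of_mul hne), ?_, rfl⟩
    exact hne
  · congr 2
    exact (Finsupp.equivFunOnFinite.symm_apply_apply m).symm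

theorem polyMap_smul {n N d : ℕ} {h : Fin N → MvPolynomial (Fin n) ℂ}
    (hh : ∀ j, (h j).IsHomogeneous d) (t : ℂ) (z : CSpace n) :
    polyMap h (t • z) = t ^ d • polyMap h z := by
  ext j
  rw [PiLp.smul_apply, polyMap_apply, polyMap_apply, (hh j).eval_eq_sum_multiIndex,
    (hh j).eval_eq_sum_multiIndex, smul_eq_mul, Finset.mul_sum]
  refine Finset.sum_congr rfl fun α _ => ?_
  have hα := (Finset.mem_piAntidiag.1 α.2).1
  simp only [PiLp.smul_apply, smul_eq_mul, mul_pow, Finset.prod_mul_distrib,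
    Finset.prod_pow_eq_pow_sum, hα]
  ring

theorem norm_polyMap_eq_pow {n N d : ℕ} (hd : 1 ≤ d) {h : Fin N → MvPolynomial (Fin n) ℂ}
    (hh : ∀ j, (h j).IsHomogeneous d) (h1 : ∀ z : CSpace n, ‖z‖ = 1 → ‖polyMap h z‖ = 1)
    (z : CSpace n) : ‖polyMap h z‖ = ‖z‖ ^ d := by
  by_cases hz : z = 0
  · have := polyMap_smul hh 0 z
    rw [zero_smul, zero_pow (by omega), zero_smul] at this
    rw [hz, this, norm_zero, norm_zero, zero_pow (by omega)]
  · have hz' : (‖z‖ : ℂ) ≠ 0 := by exact_mod_cast norm_ne_zero_iff.2 hz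
    have := polyMap_smul hh (‖z‖ : ℂ) ((‖z‖ : ℂ)⁻¹ • z)
    rw [smul_inv_smul₀ hz'] at this
    rw [this, norm_smul, h1, mul_one, norm_pow, Complex.norm_real, norm_norm]
    rw [norm_smul, norm_inv, Complex.norm_real, norm_norm, inv_mul_cancel₀ (norm_ne_zero_iff.2 hz)]

/-- Polarization of `‖h(z)‖² = ‖z‖ ^ (2 d)`. -/
theorem inner_polyMap_eq_pow {n N d : ℕ} {h : Fin N → MvPolynomial (Fin n) ℂ}
    (hnorm : ∀ z : CSpace n, ‖polyMap h z‖ = ‖z‖ ^ d) (z w : CSpace n) :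
    inner ℂ (polyMap h w) (polyMap h z) = inner ℂ w z ^ d := by
  set P : MvPolynomial (Fin n ⊕ Fin n) ℂ :=
    ∑ j, rename Sum.inl (h j) * rename Sum.inr (map (starRingEnd ℂ) (h j)) -
      (∑ i, X (Sum.inl i) * X (Sum.inr i)) ^ d with hP
  have key : ∀ z w : CSpace n, eval (Sum.elim z fun i => conj (w i)) P =
      inner ℂ (polyMap h w) (polyMap h z) - inner ℂ w z ^ d := by
    intro z w
    rw [inner_polyMap]
    simp only [hP, map_sub, map_sum, map_mul, map_pow, eval_rename, eval_X, Sum.elim_inl,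
      Sum.elim_inr, ← eval_map_conj, PiLp.inner_apply, RCLike.inner_apply]
    rfl
  have hP0 : P = 0 := by
    refine eq_zero_of_eval_conj P fun z => ?_
    refine (key (WithLp.toLp 2 z) (WithLp.toLp 2 z)).trans ?_
    rw [inner_self_eq_norm_sq_to_K, inner_self_eq_norm_sq_to_K, hnorm]
    push_cast
    ring
  have := key z w
  rw [hP0, map_zero] at this
  exact (sub_eq_zero.1 this.symm)

/-- A homogeneous polynomial map with `‖h(z)‖ = ‖z‖ ^ d` whose values span `ℂᴺ` is `U ∘ H_d` for a
unitary map `U`. -/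
theorem exists_linearIsometryEquiv_of_homogeneous {n N d : ℕ}
    {h : Fin N → MvPolynomial (Fin n) ℂ} (hh : ∀ j, (h j).IsHomogeneous d)
    (hnorm : ∀ z : CSpace n, ‖polyMap h z‖ = ‖z‖ ^ d)
    (hspan : Submodule.span ℂ (Set.range (polyMap h)) = ⊤) :
    ∃ U : EuclideanSpace ℂ (MultiIndex n d) ≃ₗᵢ[ℂ] CSpace N,
      ∀ z, polyMap h z = U (homogeneousMap n d z) := by
  set L : EuclideanSpace ℂ (MultiIndex n d) →ₗ[ℂ] CSpace N :=
    { toFun := fun e => WithLp.toLp 2 fun j => ∑ α : MultiIndex n d,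
        coeff (Finsupp.equivFunOnFinite.symm α.1) (h j) /
          ((Real.sqrt (Nat.multinomial Finset.univ α.1 : ℝ) : ℝ) : ℂ) * e α
      map_add' := fun e e' => by
        ext j
        simp [mul_add, Finset.sum_add_distrib]
      map_smul' := fun c e => by
        ext j
        simp only [PiLp.smul_apply, smul_eq_mul, RingHom.id_apply, Finset.mul_sum]
        exact Finset.sum_congr rfl fun α _ => by ring } with hL
  have hLH : ∀ z, L (homogeneousMap n d z) = polyMap h z := by
    intro z
    ext j
    rw [polyMap_apply, (hh j).eval_eq_sum_multiIndex]
    change ∑ α : MultiIndex n d, _ = _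
    refine Finset.sum_congr rfl fun α _ => ?_
    rw [homogeneousMap_apply, ← mul_assoc, div_mul_cancel₀ _ (sqrt_multinomial_ne_zero α.1)]
  have hadj : L.adjoint ∘ₗ L = LinearMap.id := by
    refine LinearMap.ext_on (span_range_homogeneousMap n d) ?_
    rintro _ ⟨z, rfl⟩
    rw [LinearMap.comp_apply, LinearMap.id_apply, ← sub_eq_zero]
    -- `L† L H_d(z) - H_d(z)` is orthogonal to all values of `H_d`.
    have h0 : innerₛₗ ℂ (L.adjoint (L (homogeneousMap n d z)) - homogeneousMap n d z) = 0 := by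
      refine LinearMap.ext_on (span_range_homogeneousMap n d) ?_
      rintro _ ⟨w, rfl⟩
      rw [innerₛₗ_apply_apply, inner_sub_left, LinearMap.adjoint_inner_left, hLH, hLH,
        inner_polyMap_eq_pow hnorm, inner_homogeneousMap, sub_self, LinearMap.zero_apply]
    exact inner_self_eq_zero.1 (LinearMap.congr_fun h0 _)
  have hinner : ∀ a b, inner ℂ (L a) (L b) = inner ℂ a b := by
    intro a b
    rw [← LinearMap.adjoint_inner_right, ← LinearMap.comp_apply, hadj, LinearMap.id_apply]
  have hsurj : Function.Surjective (L.isometryOfInner hinner) := by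
    have : LinearMap.range L = ⊤ := by
      rw [eq_top_iff, ← hspan, Submodule.span_le]
      rintro _ ⟨z, rfl⟩
      exact ⟨_, hLH z⟩
    exact LinearMap.range_eq_top.1 this
  exact ⟨LinearIsometryEquiv.ofSurjective (L.isometryOfInner hinner) hsurj, fun z => (hLH z).symm⟩

end HomogeneousMaps

/-! ### Rational proper maps of balls that map a sphere to a sphere -/

theorem theorem1p3 (n N : ℕ) (hn : 2 ≤ n)
    (f : unitBall n → unitBall N)
    (hrat : IsRationalMap (fun z => (f z : CSpace N)))
    (hproper : IsProperMap f)
    (hk : (generalHyperplaneRank (fun z => (f z : CSpace N)) : ℤ) = (N : ℤ) - 1)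
    (r R : ℝ) (hr : r ∈ Set.Ioo (0 : ℝ) 1) (hR : R ∈ Set.Ioo (0 : ℝ) 1)
    (hsphere : ∀ z : unitBall n, ‖(z : CSpace n)‖ = r → ‖(f z : CSpace N)‖ = R) :
    ∃ d : ℕ, 1 ≤ d ∧ N = (n + d - 1).choose d ∧
      ∃ U : EuclideanSpace ℂ (MultiIndex n d) ≃ₗᵢ[ℂ] CSpace N,
        ∀ z : unitBall n, (f z : CSpace N) = U (homogeneousMap n d (z : CSpace n)) := by
  obtain ⟨hr0, hr1⟩ := hr
  obtain ⟨hR0, hR1⟩ := hR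
  obtain ⟨p, q, hpq⟩ := hrat
  have hq : ∀ z ∈ unitBall n, MvPolynomial.eval z q ≠ 0 := fun z hz => (hpq ⟨z, hz⟩).1
  set F : CSpace n → CSpace N := fun z => (MvPolynomial.eval z q)⁻¹ • polyMap p z with hF
  have hFf : ∀ z : unitBall n, F z = f z := by
    intro z
    ext j
    rw [(hpq z).2 j, hF, PiLp.smul_apply, polyMap_apply, smul_eq_mul, div_eq_inv_mul]
  have hk' : generalHyperplaneRank (fun z : unitBall n => F z) + 1 = N := by
    simp only [hFf]
    omega
  have hFp : ∀ z ∈ unitBall n, ‖F z‖ ^ 2 * ‖MvPolynomial.eval z q‖ ^ 2 = ‖polyMap p z‖ ^ 2 := by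
    intro z hz
    have := norm_ne_zero_iff.2 (hq z hz)
    rw [hF, norm_smul, norm_inv]
    field_simp
  have h1 : ∀ z : CSpace n, ‖z‖ ^ 2 = 1 → ‖polyMap p z‖ ^ 2 = ‖MvPolynomial.eval z q‖ ^ 2 := by
    intro z hz
    have hz1 : ‖z‖ = 1 := (sq_eq_sq₀ (norm_nonneg z) zero_le_one).1 (by rw [hz, one_pow])
    have := neBot_nhdsWithin_unitBall hz1
    have hqc : Continuous fun z : CSpace n => MvPolynomial.eval z q :=
      (MvPolynomial.continuous_eval q).comp (PiLp.continuous_ofLp 2 _)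
    have hlim := ((tendsto_norm_of_isProperMap hproper hFf hz1).pow 2).mul
      ((hqc.norm.pow 2).continuousWithinAt (s := unitBall n) (x := z))
    have hlim' := ((continuous_polyMap p).norm.pow 2).continuousWithinAt (s := unitBall n) (x := z)
    rw [one_pow, one_mul] at hlim
    refine tendsto_nhds_unique_of_eventuallyEq hlim' hlim ?_
    filter_upwards [self_mem_nhdsWithin] with w hw
    exact (hFp w hw).symm
  have h2 : ∀ z : CSpace n, ‖z‖ ^ 2 = r ^ 2 →
      ‖polyMap p z‖ ^ 2 = R ^ 2 * ‖MvPolynomial.eval z q‖ ^ 2 := by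
    intro z hz
    have hzr : ‖z‖ = r := (sq_eq_sq₀ (norm_nonneg z) hr0.le).1 hz
    have hzb : z ∈ unitBall n := by rw [mem_ball_zero_iff, hzr]; exact hr1
    rw [← hFp z hzb, hFf ⟨z, hzb⟩, hsphere ⟨z, hzb⟩ hzr]
  obtain ⟨⟨y, hy⟩, hdil⟩ := dilation_of_generalHyperplaneRank (by omega) hq (fun _ _ => rfl) hk'
    (by positivity : 0 < r ^ 2) h1 h2
  have hq0 : MvPolynomial.eval 0 q ≠ 0 := hq 0 (by simp)
  by_cases hd : ∃ d : ℕ, ((r ^ 2 : ℝ) : ℂ) ^ d = ((R ^ 2 : ℝ) : ℂ)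
  · obtain ⟨d, hd⟩ := hd
    have ha : ∀ m d : ℕ, ((r ^ 2 : ℝ) : ℂ) ^ m = ((r ^ 2 : ℝ) : ℂ) ^ d → m = d := by
      intro m d hmd
      refine pow_right_injective₀ (by positivity : 0 < r ^ 2) (by nlinarith) ?_
      exact_mod_cast hmd
    have hd1 : 1 ≤ d := by
      by_contra hd0
      have : d = 0 := by omega
      rw [this, pow_zero] at hd
      have : R ^ 2 = 1 := by exact_mod_cast hd.symm
      nlinarith
    set h : Fin N → MvPolynomial (Fin n) ℂ := fun j =>
      MvPolynomial.C (MvPolynomial.eval 0 q)⁻¹ * MvPolynomial.homogeneousComponent d (p j) with hh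
    have hhom : ∀ j, (h j).IsHomogeneous d := fun j =>
      (MvPolynomial.homogeneousComponent_isHomogeneous d (p j)).C_mul _
    have hFh : ∀ z ∈ unitBall n, F z = polyMap h z := by
      intro z hz
      ext j
      rw [hF, PiLp.smul_apply, polyMap_apply, polyMap_apply, smul_eq_mul,
        MvPolynomial.eval_eq_of_dilation ha hq0 (hdil j) hd, mul_comm,
        mul_inv_cancel_right₀ (hq z hz)]
    have hnorm := norm_polyMap_eq_pow hd1 hhom fun z hz => by
      have := neBot_nhdsWithin_unitBall hz
      refine tendsto_nhds_unique_of_eventuallyEq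
        ((continuous_polyMap h).norm.continuousWithinAt (s := unitBall n) (x := z))
        (tendsto_norm_of_isProperMap hproper hFf hz) ?_
      filter_upwards [self_mem_nhdsWithin] with w hw
      rw [hFh w hw]
    have hspan : Submodule.span ℂ (Set.range (polyMap h)) = ⊤ := by
      rw [eq_top_iff, ← hy.span_eq_top_of_card_eq_finrank' (by simp)]
      refine Submodule.span_mono ?_
      rintro _ ⟨i, rfl⟩
      exact ⟨y i, (hFh _ (y i).2).symm⟩
    obtain ⟨U, hU⟩ := exists_linearIsometryEquiv_of_homogeneous hhom hnorm hspan
    refine ⟨d, hd1, ?_, U, fun z => by rw [← hFf, hFh _ z.2, hU]⟩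
    have := U.toLinearEquiv.finrank_eq
    rw [finrank_euclideanSpace, finrank_euclideanSpace, card_multiIndex, Fintype.card_fin] at this
    exact this.symm
  · -- If no power of `r²` equals `R²`, then `F = 0`, but `F` has `N ≥ 1` independent values.
    push Not at hd
    refine absurd ?_ (hy.ne_zero ⟨0, by omega⟩)
    ext j
    simp only [PiLp.smul_apply, polyMap_apply,
      MvPolynomial.eval_eq_zero_of_dilation hq0 (hdil j) hd, smul_zero, PiLp.zero_apply]
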